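/- Let $F$ be the field of meromorphic functions on $\mathbb{C}$ in the variable $x$, let $\tau\colon F\to F$ be the shift $\tau(h)(x)=h(x+1)$, and let $\partial=\frac{d}{dx}$. Let $k=\{h\in F:\tau(h)=h\}$ be the field of meromorphic $1$-periodic functions and $K=k(x)\subset F$. An element $z\in F$ is called differentially algebraic over $K$ if $z,\partial(z),\dots,\partial^n(z)$ are algebraically dependent over $K$ for some integer $n\ge 0$; it is called $D$-finite over $K$ if it is differentially algebraic over $K$ and satisfies a nontrivial linear differential equation $a_0z+a_1\partial(z)+\dots+a_n\partial^n(z)=0$ with $n\geq 0$ and $a_0,\dots,a_n\in K$ not all zero. Let $f\in K$, $f\neq 0$, and let $z\in F$ be such that $\tau(z)=z+f$. The following assertions are equivalent: 1. $z$ is differentially algebraic over $K$. 2. $z$ is $D$-finite over $K$. 3. There exist a positive integer $n$, elements $\lambda_0,\dots,\lambda_n\in k$, not all zero, and $g\in K$ such that $$\lambda_0 f+\lambda_1\partial(f)+\dots+\lambda_n\partial^n(f)=g(x+1)-g(x).$$ If $f\in\mathbb{C}(x)$ (resp. $f\in\overline{\mathbb{Q}}(x)$, where $\overline{\mathbb{Q}}$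 is the algebraic closure of $\mathbb{Q}$ in $\mathbb{C}$), then they are also equivalent to: 4. There exist a positive integer $n$, elements $\lambda_0,\dots,\lambda_n\in\mathbb{C}$ (resp. $\in\overline{\mathbb{Q}}$), not all zero, and $g\in\mathbb{C}(x)$ (resp. $g\in\overline{\mathbb{Q}}(x)$) such that $$\lambda_0 f+\lambda_1\partial(f)+\dots+\lambda_n\partial^n(f)=g(x+1)-g(x).$$ -/

import Mathlib

section

open Filter Topology
open scoped IntermediateField

/-! ### The field of meromorphic functions on `ℂ`

A meromorphic function on `ℂ` is the class of a function `f : ℂ → ℂ` that is meromorphic at every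
point, where two functions are identified when they agree on a punctured neighbourhood of every
point (that is, off a closed discrete set: values at poles and at removable singularities are
irrelevant). -/

/-- Functions `ℂ → ℂ` that are meromorphic at every point. -/
def meromorphicAlg : Subalgebra ℂ (ℂ → ℂ) where
  carrier := {f | ∀ a, MeromorphicAt f a}
  mul_mem' hf hg a := (hf a).mul (hg a)
  add_mem' hf hg a := (hf a).add (hg a)
  algebraMap_mem' c a := MeromorphicAt.const c a

/-- The functions that vanish on a punctured neighbourhood of every point. -/
def negligibleIdeal : Ideal meromorphicAlg where
  carrier := {f | ∀ a, ∀ᶠ x in 𝓝[≠] a, f.1 x = 0}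
  add_mem' hf hg a := by
    filter_upwards [hf a, hg a] with x h1 h2
    exact (congrArg₂ (· + ·) h1 h2).trans (add_zero 0)
  zero_mem' a := Eventually.of_forall fun _ => rfl
  smul_mem' c f hf a := by
    filter_upwards [hf a] with x h
    exact (congrArg (c.1 x * ·) h).trans (mul_zero _)

theorem mem_negligibleIdeal {f : meromorphicAlg} :
    f ∈ negligibleIdeal ↔ ∀ a, ∀ᶠ x in 𝓝[≠] a, f.1 x = 0 := Iff.rfl

theorem eventually_ne_zero_of_notMem {f : meromorphicAlg} (hf : f ∉ negligibleIdeal) (a : ℂ) :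
    ∀ᶠ x in 𝓝[≠] a, f.1 x ≠ 0 := by
  rw [mem_negligibleIdeal, not_forall] at hf
  obtain ⟨b, hb⟩ := hf
  have hb' : meromorphicOrderAt f.1 b ≠ ⊤ := by
    rw [Ne, meromorphicOrderAt_eq_top_iff]
    exact hb
  have hM : MeromorphicOn f.1 Set.univ := fun x _ => f.2 x
  exact (meromorphicOrderAt_ne_top_iff_eventually_ne_zero (f.2 a)).1
    (hM.meromorphicOrderAt_ne_top_of_isPreconnected isPreconnected_univ
      (Set.mem_univ b) (Set.mem_univ a) hb')

instance negligibleIdeal_isMaximal : negligibleIdeal.IsMaximal := by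
  rw [Ideal.isMaximal_iff]
  refine ⟨fun h => ?_, fun J f hJ hf hfJ => ?_⟩
  · obtain ⟨x, hx⟩ := (mem_negligibleIdeal.1 h 0).exists
    exact one_ne_zero hx
  · let g : meromorphicAlg := ⟨f.1⁻¹, fun a => (f.2 a).inv⟩
    have h1 : 1 - g * f ∈ negligibleIdeal := fun a => by
      filter_upwards [eventually_ne_zero_of_notMem hf a] with x hx
      show (1 : ℂ) - (f.1 x)⁻¹ * f.1 x = 0
      rw [inv_mul_cancel₀ hx, sub_self]
    have := J.add_mem (hJ h1) (J.mul_mem_left g hfJ)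
    rwa [sub_add_cancel] at this

/-- The field of meromorphic functions on `ℂ`. -/
def Mero : Type := meromorphicAlg ⧸ negligibleIdeal

namespace Mero

noncomputable instance : CommRing Mero :=
  inferInstanceAs (CommRing (meromorphicAlg ⧸ negligibleIdeal))

noncomputable instance : Field Mero where
  __ := (inferInstance : CommRing Mero)
  inv := (Ideal.Quotient.field negligibleIdeal).inv
  exists_pair_ne := (Ideal.Quotient.field negligibleIdeal).exists_pair_ne
  mul_inv_cancel := (Ideal.Quotient.field negligibleIdeal).mul_inv_cancel
  inv_zero := (Ideal.Quotient.field negligibleIdeal).inv_zero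
  nnqsmul := _
  nnqsmul_def := fun _ _ => rfl
  qsmul := _
  qsmul_def := fun _ _ => rfl

/-- The class of a function, as a ring homomorphism. -/
noncomputable def mkHom : meromorphicAlg →+* Mero := Ideal.Quotient.mk negligibleIdeal

noncomputable instance : Algebra ℂ Mero := (mkHom.comp (algebraMap ℂ meromorphicAlg)).toAlgebra

/-- The meromorphic function represented by `f : ℂ → ℂ`. -/
noncomputable def mk : meromorphicAlg →ₐ[ℂ] Mero := { mkHom with commutes' := fun _ => rfl }

theorem mk_surjective : Function.Surjective mk :=
  Ideal.Quotient.mk_surjective (I := negligibleIdeal)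

theorem mk_eq_mk {f g : meromorphicAlg} :
    mk f = mk g ↔ ∀ a, ∀ᶠ x in 𝓝[≠] a, f.1 x = g.1 x := by
  refine (Ideal.Quotient.eq (I := negligibleIdeal)).trans ?_
  rw [mem_negligibleIdeal]
  exact forall_congr' fun a => eventually_congr (Eventually.of_forall fun x => sub_eq_zero)

/-- The meromorphic function `x`. -/
noncomputable def X : Mero := mk ⟨fun x => x, fun a => MeromorphicAt.id a⟩

/-- `f(x) ↦ f(x + 1)` on functions. -/
def shiftFun : meromorphicAlg →ₐ[ℂ] meromorphicAlg where
  toFun f := ⟨fun x => f.1 (x + 1), fun a =>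
    (f.2 (a + 1)).comp_analyticAt (g := fun x => x + 1) (by fun_prop)⟩
  map_one' := rfl
  map_mul' _ _ := rfl
  map_zero' := rfl
  map_add' _ _ := rfl
  commutes' _ := rfl

theorem shiftFun_congr {f g : meromorphicAlg} (h : mk f = mk g) :
    mk (shiftFun f) = mk (shiftFun g) := by
  rw [mk_eq_mk] at h ⊢
  intro a
  have ht : Tendsto (fun x : ℂ => x + 1) (𝓝[≠] a) (𝓝[≠] (a + 1)) := by
    refine tendsto_nhdsWithin_of_tendsto_nhds_of_eventually_within _ ?_ ?_
    · exact ((continuous_add_const (1 : ℂ)).tendsto a).mono_left nhdsWithin_le_nhds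
    · filter_upwards [self_mem_nhdsWithin] with x hx
      simpa using hx
  exact ht.eventually (h (a + 1))

/-- The shift `τ : f(x) ↦ f(x + 1)` of the field of meromorphic functions. -/
noncomputable def shift : Mero →+* Mero :=
  Ideal.Quotient.lift negligibleIdeal (mk.comp shiftFun).toRingHom fun f hf => by
    have h0 : mk f = mk 0 := by rw [map_zero]; exact Ideal.Quotient.eq_zero_iff_mem.2 hf
    have h1 := shiftFun_congr h0
    rw [map_zero shiftFun, map_zero mk] at h1
    exact h1

@[simp] theorem shift_mk (f : meromorphicAlg) : shift (mk f) = mk (shiftFun f) := rfl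

/-- `f ↦ f'` on functions. -/
noncomputable def derivFun (f : meromorphicAlg) : meromorphicAlg :=
  ⟨deriv f.1, fun a => (f.2 a).deriv⟩

theorem derivFun_congr {f g : meromorphicAlg} (h : mk f = mk g) :
    mk (derivFun f) = mk (derivFun g) := by
  rw [mk_eq_mk] at h ⊢
  intro a
  have h' := eventually_eventually_nhdsWithin.2 (h a)
  filter_upwards [h', self_mem_nhdsWithin] with x hx hxa
  rw [IsOpen.nhdsWithin_eq isOpen_compl_singleton hxa] at hx
  exact EventuallyEq.deriv_eq hx

theorem eventually_differentiableAt (f : meromorphicAlg) (a : ℂ) :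
    ∀ᶠ x in 𝓝[≠] a, DifferentiableAt ℂ f.1 x := by
  filter_upwards [(f.2 a).eventually_analyticAt] with x hx using hx.differentiableAt

/-- `f ↦ f'` on classes of functions. -/
noncomputable def derivMap : Mero → Mero :=
  fun F => Quotient.liftOn' (s₁ := Submodule.quotientRel negligibleIdeal) F
    (fun f => mk (derivFun f)) fun f g h =>
      derivFun_congr (show mk f = mk g from Quotient.sound' h)

theorem derivMap_mk (f : meromorphicAlg) : derivMap (mk f) = mk (derivFun f) := rfl

/-- `derivMap` as a `ℂ`-linear map. -/
noncomputable def derivLin : Mero →ₗ[ℂ] Mero where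
  toFun := derivMap
  map_add' := fun F G => by
    obtain ⟨f, rfl⟩ := mk_surjective F
    obtain ⟨g, rfl⟩ := mk_surjective G
    rw [← map_add, derivMap_mk, derivMap_mk, derivMap_mk, ← map_add, mk_eq_mk]
    intro a
    filter_upwards [eventually_differentiableAt f a, eventually_differentiableAt g a]
      with x hf hg
    exact deriv_add hf hg
  map_smul' := fun c F => by
    obtain ⟨f, rfl⟩ := mk_surjective F
    rw [← map_smul, derivMap_mk, derivMap_mk, RingHom.id_apply, ← map_smul, mk_eq_mk]
    intro a
    filter_upwards [eventually_differentiableAt f a] with x hf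
    exact deriv_const_smul c hf

/-- The derivation `∂ = d/dx` of the field of meromorphic functions. -/
noncomputable def ddx : Derivation ℂ Mero Mero :=
  Derivation.mk' derivLin
    fun F G => by
      obtain ⟨f, rfl⟩ := mk_surjective F
      obtain ⟨g, rfl⟩ := mk_surjective G
      show derivMap (mk f * mk g) = mk f * derivMap (mk g) + mk g * derivMap (mk f)
      rw [← map_mul, derivMap_mk, derivMap_mk, derivMap_mk, ← map_mul, ← map_mul, ← map_add,
        mk_eq_mk]
      intro a
      filter_upwards [eventually_differentiableAt f a, eventually_differentiableAt g a]
        with x hf hg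
      refine (deriv_mul hf hg).trans ?_
      show deriv f.1 x * g.1 x + f.1 x * deriv g.1 x = f.1 x * deriv g.1 x + g.1 x * deriv f.1 x
      ring

theorem ddx_mk (f : meromorphicAlg) : ddx (mk f) = mk (derivFun f) := rfl

/-- The field `k` of meromorphic `1`-periodic functions. -/
noncomputable def periodic : Subfield Mero := shift.eqLocusField (RingHom.id Mero)

/-- The field `C(x)` of rational functions with coefficients in `C`, as a subfield of the field of
meromorphic functions. -/
noncomputable abbrev ratFunc (C : Type) [Field C] [Algebra C Mero] : IntermediateField C Mero :=
  C⟮X⟯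

/-- Some nontrivial `C`-linear combination of `f, ∂f, …, ∂ⁿf` is of the form `g(x+1) - g(x)` with
`g ∈ C(x)`. -/
def HasShiftRelation (C : Type) [Field C] [Algebra C Mero] (f : Mero) : Prop :=
  ∃ n : ℕ, 0 < n ∧ ∃ c : Fin (n + 1) → C, c ≠ 0 ∧ ∃ g ∈ ratFunc C,
    ∑ i, c i • ddx^[i] f = shift g - g

end Mero

end

/-! ### Differential algebraicity and D-finiteness -/

/-- `z, ∂z, …, ∂ⁿz` are algebraically dependent over `K` for some `n`. -/
def IsDifferentiallyAlgebraic {R F : Type*} [CommRing R] [Field F] [Algebra R F]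
    (d : Derivation R F F) (K : Type*) [Field K] [Algebra K F] (z : F) : Prop :=
  ∃ n : ℕ, ¬ AlgebraicIndependent K fun i : Fin (n + 1) => d^[i] z

/-- `z` is differentially algebraic and solves a nontrivial homogeneous linear differential
equation with coefficients in `K`. -/
def IsDFinite {R F : Type*} [CommRing R] [Field F] [Algebra R F]
    (d : Derivation R F F) (K : Type*) [Field K] [Algebra K F] (z : F) : Prop :=
  IsDifferentiallyAlgebraic d K z ∧
    ∃ n : ℕ, ∃ a : Fin (n + 1) → K, a ≠ 0 ∧ ∑ i, a i • d^[i] z = 0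

/-! Since `shift` commutes with `ddx`, every derivative of z satisfies an equation σ(zᵢ) = zᵢ + fᵢ
with fᵢ = ∂ⁱf. A polynomial relation P of minimal size among the zᵢ must be proportional to its
transform P^τ(Y + f), which also vanishes at z. Comparing top-degree coefficients shows that they
are τ-invariant up to one common factor; comparing coefficients one degree lower yields a linear
telescoping relation among the fᵢ. This is `exists_telescoper_of_not_algebraicIndependent`, and
gives 1 → 3.

For 3 → 2, put w = ∑ cᵢ ∂ⁱz. Then w - g is periodic, so w lies in K: z solves an inhomogeneous
linear equation over K, and one differentiation makes it homogeneous. A linear relation is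
algebraic, so 2 → 1 costs nothing.

For 4, a relation over k involves finitely many elements of k. They generate a C-algebra of finite
type, and the Nullstellensatz specializes them to C (`exists_telescoper_of_extension`). -/

/-! ### Algebraic dependence of solutions of `σ z = z + f` -/

namespace MvPolynomial

variable {ι K : Type*} [Fintype ι] [Field K]

/-- The coefficients of `p(Y + f)` in degrees at least `deg p - 1`. -/
theorem coeff_translate (f : ι → K) (p : MvPolynomial ι K) (m : ι →₀ ℕ)
    (hp : ∀ e, coeff e p ≠ 0 → e.degree ≤ m.degree + 1) :
    coeff m (aeval (fun i => X i + C (f i)) p) =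
      coeff m p + ∑ i, f i * coeff m (pderiv i p) := by
  -- This is Taylor's formula: derivatives of order at least 2 lower the degree too much to reach
  -- `m`. Both sides are linear in `p`, so monomials suffice.
  have key : ∀ (e : ι →₀ ℕ) (a : K) (m : ι →₀ ℕ),
      (∀ e', coeff e' (monomial e a) ≠ 0 → e'.degree ≤ m.degree + 1) →
      coeff m (aeval (fun i => X i + C (f i)) (monomial e a)) =
        coeff m (monomial e a) + ∑ i, f i * coeff m (pderiv i (monomial e a)) := by
    intro e a
    refine induction_on_monomial (motive := fun p => ∀ m : ι →₀ ℕ,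
      (∀ e', coeff e' p ≠ 0 → e'.degree ≤ m.degree + 1) →
      coeff m (aeval (fun i => X i + C (f i)) p) =
        coeff m p + ∑ i, f i * coeff m (pderiv i p)) ?_ ?_ e a
    · intro a m _
      simp
    · intro q n ih m hm
      classical
      have hq : ∀ e', coeff e' q ≠ 0 → e'.degree ≤ m.degree := fun e' he' => by
        have := hm (e' + Finsupp.single n 1) (by rwa [coeff_mul_X])
        simpa using this
      -- In its top degree, `q` is unchanged by translation.
      have h1 : coeff m (aeval (fun i => X i + C (f i)) q) = coeff m q := by
        rw [ih m fun e' he' => (hq e' he').trans (Nat.le_succ _)]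
        refine (add_eq_left).2 (Finset.sum_eq_zero fun i _ => ?_)
        rw [coeff_pderiv]
        by_cases h : coeff (m + Finsupp.single i 1) q = 0
        · simp [h]
        · have := hq _ h
          simp at this
      have h2 : ∀ i, coeff m (pderiv i (q * X n)) =
          (if n ∈ m.support then coeff (m - Finsupp.single n 1) (pderiv i q) else 0) +
            (if i = n then coeff m q else 0) := by
        intro i
        rw [pderiv_mul, coeff_add, coeff_mul_X']
        by_cases h : i = n
        · subst h; simp
        · simp [pderiv_X_of_ne (Ne.symm h), h]
      simp_rw [h2]
      rw [map_mul, aeval_X, mul_add, coeff_add, coeff_mul_X', mul_comm _ (C (f n)), coeff_C_mul,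
        h1, coeff_mul_X']
      simp only [mul_add, Finset.sum_add_distrib, mul_ite, mul_zero, Finset.sum_ite_eq',
        Finset.mem_univ, if_true]
      by_cases hn : n ∈ m.support
      · simp only [hn, if_true]
        rw [ih (m - Finsupp.single n 1)]
        · ring
        · intro e' he'
          have h3 : m - Finsupp.single n 1 + Finsupp.single n 1 = m :=
            tsub_add_cancel_of_le (Finsupp.single_le_iff.2
              (Nat.one_le_iff_ne_zero.2 (Finsupp.mem_support_iff.1 hn)))
          have h4 := congrArg Finsupp.degree h3
          simp only [map_add, Finsupp.degree_single] at h4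
          exact (hq e' he').trans h4.ge
      · simp [hn]
  have hsum := p.as_sum
  have hL : ∀ φ : MvPolynomial ι K →ₗ[K] K,
      φ p = ∑ e ∈ p.support, φ (monomial e (coeff e p)) := fun φ => by
    conv_lhs => rw [hsum]
    exact map_sum φ _ _
  have e1 := hL ((lcoeff K m).comp (aeval (fun i => X i + C (f i))).toLinearMap)
  have e2 := hL (lcoeff K m + ∑ i, f i • (lcoeff K m).comp (pderiv i).toLinearMap)
  simp only [LinearMap.add_apply, LinearMap.sum_apply, LinearMap.smul_apply,
    LinearMap.comp_apply, lcoeff_apply, AlgHom.toLinearMap_apply, smul_eq_mul] at e1 e2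
  refine e1.trans (Eq.trans ?_ e2.symm)
  refine Finset.sum_congr rfl fun e he => key e _ m fun e' he' => ?_
  classical
  rw [coeff_monomial] at he'
  have : e = e' := by by_contra h; simp [h] at he'
  exact this ▸ hp e (mem_support_iff.1 he)

end MvPolynomial

open MvPolynomial in
/-- If `σ zᵢ = zᵢ + fᵢ` and the `zᵢ` are algebraically dependent over `K ∋ fᵢ`, then some
combination of the `fᵢ` with invariant coefficients is of the form `τ g - g` with `g ∈ K`. -/
theorem exists_telescoper_of_not_algebraicIndependent {K F ι : Type*} [Field K] [Field F]
    [Algebra K F] [CharZero K] [Fintype ι] (σ : F →+* F) (τ : K →+* K)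
    (hτ : ∀ a, σ (algebraMap K F a) = algebraMap K F (τ a)) (z : ι → F) (f : ι → K)
    (hz : ∀ i, σ (z i) = z i + algebraMap K F (f i)) (h : ¬ AlgebraicIndependent K z) :
    ∃ c : ι → K, c ≠ 0 ∧ (∀ i, τ (c i) = c i) ∧ ∃ g, ∑ i, c i * f i = τ g - g := by
  classical
  let top (p : MvPolynomial ι K) : Finset (ι →₀ ℕ) :=
    p.support.filter fun e => e.degree = p.totalDegree
  -- The total degree alone need not drop when one leading term is cancelled, so the top-degree
  -- monomials are counted as well.
  let μ (p : MvPolynomial ι K) : ℕ ×ₗ ℕ := toLex (p.totalDegree, (top p).card)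
  let S : Set (MvPolynomial ι K) := {p | p ≠ 0 ∧ aeval z p = 0}
  have hS : S.Nonempty := by
    rw [algebraicIndependent_iff] at h
    push Not at h
    obtain ⟨p, hp, hp0⟩ := h
    exact ⟨p, hp0, hp⟩
  obtain ⟨P₀, ⟨hP₀, hP₀z⟩, hmin₀⟩ :=
    WellFounded.has_min (InvImage.wf μ (wellFounded_lt (α := ℕ ×ₗ ℕ))) S hS
  have hdeg : ∀ {p : MvPolynomial ι K} {e}, coeff e p ≠ 0 → e.degree ≤ p.totalDegree :=
    fun he => le_totalDegree (mem_support_iff.2 he)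
  obtain ⟨e₀, he₀, hmax⟩ := Finset.exists_mem_eq_sup P₀.support (support_nonempty.2 hP₀)
    (fun s => s.sum fun _ e => e)
  replace hmax : e₀.degree = P₀.totalDegree := hmax.symm
  set a := coeff e₀ P₀ with ha_def
  have ha : a ≠ 0 := mem_support_iff.1 he₀
  have hτa : τ a ≠ 0 := (map_ne_zero τ).2 ha
  let P₁ := map τ P₀
  let T := aeval (fun i => X i + C (f i)) P₁
  have hP₁ : ∀ e, coeff e P₁ = τ (coeff e P₀) := fun e => coeff_map τ P₀ e
  have hP₁deg : ∀ e, coeff e P₁ ≠ 0 → e.degree ≤ P₀.totalDegree := fun e he => by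
    rw [hP₁, map_ne_zero] at he
    exact hdeg he
  have hTtop : ∀ e : ι →₀ ℕ, P₀.totalDegree ≤ e.degree → coeff e T = τ (coeff e P₀) := by
    intro e he
    rw [coeff_translate f P₁ e fun e' he' => ((hP₁deg e' he').trans he).trans (Nat.le_succ _),
      hP₁]
    refine add_eq_left.2 (Finset.sum_eq_zero fun i _ => ?_)
    rw [coeff_pderiv]
    by_cases h0 : coeff (e + Finsupp.single i 1) P₁ = 0
    · simp [h0]
    · have := (hP₁deg _ h0).trans he
      simp at this
  have hTz : aeval z T = 0 := by
    have h1 : aeval z T = σ (aeval z P₀) := by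
      simp only [T, P₁, aeval_def, algebraMap_eq]
      rw [eval₂_map]
      have : ∀ p : MvPolynomial ι K, eval₂ (algebraMap K F) z
          (eval₂ (C.comp τ) (fun i => X i + C (f i)) p) = σ (eval₂ (algebraMap K F) z p) := by
        intro p
        induction p using MvPolynomial.induction_on with
        | C b => simp [hτ]
        | add p q hp hq => simp only [eval₂_add, map_add, hp, hq]
        | mul_X p i hp => simp only [eval₂_mul, eval₂_X, eval₂_add, eval₂_C, map_mul, hp, hz]
      exact this P₀
    rw [h1, hP₀z, map_zero]
  -- This combination vanishes at `z` and cancels the monomial `e₀` without creating new top-degree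
  -- monomials, so minimality forces it to be zero.
  let R := C a * T - C (τ a) * P₀
  have hRcoeff : ∀ e, coeff e R = a * coeff e T - τ a * coeff e P₀ := fun e => by
    simp only [R, coeff_sub, coeff_C_mul]
  have hRtop : ∀ e : ι →₀ ℕ, coeff e R ≠ 0 → P₀.totalDegree ≤ e.degree →
      coeff e P₀ ≠ 0 := by
    intro e he hde h0
    apply he
    rw [hRcoeff, hTtop e hde, h0, map_zero]
    ring
  have hR : R = 0 := by
    by_contra hR0
    refine hmin₀ R ⟨hR0, by simp [R, hTz, hP₀z]⟩ ?_
    have hle : R.totalDegree ≤ P₀.totalDegree := by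
      refine Finset.sup_le fun e he => ?_
      by_contra! hlt
      exact absurd (hdeg (hRtop e (mem_support_iff.1 he) hlt.le)) (not_le.2 hlt)
    refine Prod.Lex.toLex_lt_toLex.2 ?_
    rcases hle.lt_or_eq with hlt | heq
    · exact Or.inl hlt
    · refine Or.inr ⟨heq, Finset.card_lt_card ?_⟩
      refine Finset.ssubset_iff_subset_ne.2 ⟨fun e he => ?_, fun hEq => ?_⟩
      · obtain ⟨h1, h2⟩ := Finset.mem_filter.1 he
        exact Finset.mem_filter.2
          ⟨mem_support_iff.2 (hRtop e (mem_support_iff.1 h1) (by rw [h2, heq])), by rw [h2, heq]⟩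
      · have h1 : e₀ ∈ top R := hEq ▸ Finset.mem_filter.2 ⟨he₀, hmax⟩
        refine mem_support_iff.1 (Finset.mem_filter.1 h1).1 ?_
        rw [hRcoeff, hTtop e₀ hmax.ge]
        ring
  have hrel : ∀ e, a * coeff e T = τ a * coeff e P₀ := fun e => by
    have := hRcoeff e
    rw [hR, coeff_zero] at this
    exact (sub_eq_zero.1 this.symm)
  have hinv : ∀ e : ι →₀ ℕ, P₀.totalDegree ≤ e.degree → τ (coeff e P₀) = τ a * coeff e P₀ / a :=
    fun e he => by rw [eq_div_iff ha, ← hrel e, hTtop e he, mul_comm]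
  have hpos : e₀ ≠ 0 := by
    rintro rfl
    rw [map_zero] at hmax
    rw [totalDegree_eq_zero_iff_eq_C.1 hmax.symm, aeval_C, map_eq_zero] at hP₀z
    exact ha hP₀z
  obtain ⟨j, hj⟩ := Finsupp.ne_iff.1 hpos
  let m := e₀ - Finsupp.single j 1
  have hm : m + Finsupp.single j 1 = e₀ :=
    tsub_add_cancel_of_le (Finsupp.single_le_iff.2 (Nat.one_le_iff_ne_zero.2 hj))
  have hmdeg : m.degree + 1 = P₀.totalDegree := by
    rw [← hmax, ← hm, map_add, Finsupp.degree_single]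
  have hc : ∀ i, τ (coeff m (pderiv i P₀)) = τ a * coeff m (pderiv i P₀) / a := fun i => by
    rw [coeff_pderiv, map_mul, hinv _ (by simp [hmdeg])]
    simp only [map_add, map_natCast, map_one]
    ring
  -- The relation is the coefficient of `m` in a · T = τ(a) · P₀. The entry at `j` is m j + 1,
  -- nonzero in characteristic zero.
  refine ⟨fun i => coeff m (pderiv i P₀) / a, fun h0 => ?_, fun i => ?_, -(coeff m P₀ / a), ?_⟩
  · have := congrFun h0 j
    simp only [coeff_pderiv, hm, Pi.zero_apply, ← ha_def, mul_div_right_comm, div_self ha,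
      one_mul] at this
    exact Nat.cast_add_one_ne_zero _ this
  · rw [map_div₀, hc]
    field_simp
  · have h1 := hrel m
    rw [coeff_translate f P₁ m fun e' he' => (hP₁deg e' he').trans hmdeg.ge, hP₁] at h1
    have h2 : ∑ i, f i * coeff m (pderiv i P₁) =
        τ a * ∑ i, coeff m (pderiv i P₀) / a * f i := by
      rw [Finset.mul_sum]
      refine Finset.sum_congr rfl fun i _ => ?_
      rw [pderiv_map, coeff_map, hc]
      ring
    rw [h2] at h1
    generalize ∑ i, coeff m (pderiv i P₀) / a * f i = s at h1 ⊢
    rw [map_neg, map_div₀]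
    field_simp
    linear_combination h1

/-! ### Descent of telescopers to an algebraically closed field of constants -/

/-- Weak Nullstellensatz: a nontrivial algebra of finite type over an algebraically closed field
has a rational point. -/
theorem IsAlgClosed.nonempty_algHom_of_finiteType (C A : Type*) [Field C] [IsAlgClosed C]
    [CommRing A] [Nontrivial A] [Algebra C A] [Algebra.FiniteType C A] :
    Nonempty (A →ₐ[C] C) := by
  obtain ⟨m, hm⟩ := Ideal.exists_maximal A
  let := Ideal.Quotient.field m
  -- Zariski's lemma: the residue field is finite over `C`, hence equal to `C`.
  have := finite_of_finite_type_of_isJacobsonRing C (A ⧸ m)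
  exact ⟨(AlgEquiv.ofBijective (Algebra.ofId C (A ⧸ m))
    IsAlgClosed.algebraMap_bijective_of_isIntegral).symm.toAlgHom.comp (Ideal.Quotient.mkₐ C m)⟩

section

open Polynomial
open scoped IntermediateField

/-- Membership in `C⟮x⟯` allows a vanishing denominator, with junk quotient 0; that case is
rewritten as 0/1. -/
theorem IntermediateField.exists_aeval_div_of_mem_adjoin_simple {C F : Type*} [Field C] [Field F]
    [Algebra C F] {x u : F} (hu : u ∈ C⟮x⟯) :
    ∃ r s : C[X], aeval x s ≠ 0 ∧ u = aeval x r / aeval x s := by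
  obtain ⟨r, s, h⟩ := (mem_adjoin_simple_iff C u).1 hu
  by_cases hs : aeval x s = 0
  · exact ⟨0, 1, by simp, by simp [h, hs]⟩
  · exact ⟨r, s, hs, h⟩

/-- Finitely many elements of `C(x)` have a common denominator. -/
theorem IntermediateField.exists_common_denominator {C F ι : Type*} [Field C] [Field F]
    [Algebra C F] [Fintype ι] {x : F} (u : ι → F) (hu : ∀ i, u i ∈ C⟮x⟯) :
    ∃ (N : ι → C[X]) (B : C[X]), aeval x B ≠ 0 ∧ ∀ i, u i * aeval x B = aeval x (N i) := by
  classical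
  choose r s hs h using fun i => exists_aeval_div_of_mem_adjoin_simple (hu i)
  refine ⟨fun i => r i * ∏ j ∈ Finset.univ.erase i, s j, ∏ j, s j, ?_, fun i => ?_⟩
  · rw [map_prod]
    exact Finset.prod_ne_zero_iff.2 fun i _ => hs i
  · rw [← Finset.mul_prod_erase _ s (Finset.mem_univ i), map_mul, map_mul, h i, ← mul_assoc,
      div_mul_cancel₀ _ (hs i)]

/-- If elements of `C(x)` have a telescoper with coefficients in an extension `k` of an
algebraically closed field `C`, then they have one with coefficients in `C`. -/
theorem exists_telescoper_of_extension {C k F ι : Type*} [Field C] [Field k] [Field F]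
    [Algebra C k] [Algebra k F] [Algebra C F] [IsScalarTower C k F] [IsAlgClosed C] [Fintype ι]
    {x : F} (hx : Transcendental k x) (σ : F →ₐ[k] F) (hσ : σ x = x + 1) (u : ι → F)
    (hu : ∀ i, u i ∈ C⟮x⟯) (c : ι → k) (hc : c ≠ 0) {g : F} (hg : g ∈ k⟮x⟯)
    (h : ∑ i, c i • u i = σ g - g) :
    ∃ c' : ι → C, c' ≠ 0 ∧ ∃ g' ∈ C⟮x⟯, ∑ i, c' i • u i = σ g' - g' := by
  classical
  obtain ⟨N, B, hB, hN⟩ := IntermediateField.exists_common_denominator u hu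
  obtain ⟨P, Q, hQ, rfl⟩ := IntermediateField.exists_aeval_div_of_mem_adjoin_simple hg
  obtain ⟨j, hj⟩ := Function.ne_iff.1 hc
  have hinj : Function.Injective (aeval (R := k) x) := transcendental_iff_injective.1 hx
  have hσk : ∀ p : k[X], aeval x (p.comp (X + 1)) = σ (aeval x p) := fun p => by
    rw [aeval_comp, ← aeval_algHom_apply, hσ]
    simp
  have hσC : ∀ p : C[X], aeval x (p.comp (X + 1)) = σ (aeval x p) := fun p => by
    rw [← aeval_map_algebraMap k, ← aeval_map_algebraMap k x p, ← hσk]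
    simp [Polynomial.map_comp]
  have hσQ : σ (aeval x Q) ≠ 0 := (map_ne_zero σ).2 hQ
  -- Transcendence of `x` turns the relation, cleared of denominators, into an identity of
  -- polynomials, which can be specialized coefficientwise.
  have hpoly : (∑ i, Polynomial.C (c i) * (N i).map (algebraMap C k)) * (Q * Q.comp (X + 1)) =
      B.map (algebraMap C k) * (P.comp (X + 1) * Q - P * Q.comp (X + 1)) := by
    apply hinj
    have hsum : ∑ i, c i • u i * aeval x B = ∑ i, algebraMap k F (c i) * aeval x (N i) :=
      Finset.sum_congr rfl fun i _ => by rw [smul_mul_assoc, hN, Algebra.smul_def]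
    rw [← Finset.sum_mul, h] at hsum
    simp only [map_mul, map_sub, map_sum, aeval_C, aeval_map_algebraMap, hσk, ← hsum]
    rw [map_div₀]
    field_simp
  -- The two inverses make `c j` and the leading coefficient of `Q` units of `A`, so neither the
  -- relation nor the denominator specializes to zero.
  let S : Finset k := Finset.univ.image c ∪ P.coeffs ∪ Q.coeffs ∪ {(c j)⁻¹, Q.leadingCoeff⁻¹}
  let A := Algebra.adjoin C (S : Set k)
  have hSA : ∀ y ∈ S, y ∈ A := fun y hy => Algebra.subset_adjoin hy
  have : Algebra.FiniteType C A := (Subalgebra.fg_iff_finiteType A).1 ⟨S, rfl⟩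
  obtain ⟨φ⟩ := IsAlgClosed.nonempty_algHom_of_finiteType C A
  have hlift : ∀ p : k[X], p.coeffs ⊆ S → ∃ q : A[X], q.map (A.val : A →+* k) = p := by
    intro p hp
    refine (mem_lifts (f := (A.val : A →+* k)) p).1 ((lifts_iff_coeff_lifts _).2 fun n => ?_)
    by_cases hn : p.coeff n = 0
    · exact ⟨0, by simp [hn]⟩
    · exact ⟨⟨p.coeff n, hSA _ (hp (coeff_mem_coeffs hn))⟩, rfl⟩
  obtain ⟨P', hP'⟩ := hlift P fun y hy => by simp [S, hy]
  obtain ⟨Q', hQ'⟩ := hlift Q fun y hy => by simp [S, hy]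
  let cA (i : ι) : A := ⟨c i, hSA _ (by simp [S])⟩
  have hQ0 : Q ≠ 0 := by rintro rfl; simp at hQ
  have hunit : ∀ a : A, (a : k) ≠ 0 → (a : k)⁻¹ ∈ S → φ a ≠ 0 := by
    intro a ha hb h0
    have : a * ⟨_, hSA _ hb⟩ = 1 := Subtype.ext (mul_inv_cancel₀ ha)
    simpa [h0] using congrArg φ this
  have hpolyA : (∑ i, Polynomial.C (cA i) * (N i).map (algebraMap C A)) *
      (Q' * Q'.comp (X + 1)) =
      B.map (algebraMap C A) * (P'.comp (X + 1) * Q' - P' * Q'.comp (X + 1)) := by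
    apply Polynomial.map_injective (A.val : A →+* k) Subtype.val_injective
    have h1 : (A.val : A →+* k).comp (algebraMap C A) = algebraMap C k := rfl
    simpa [Polynomial.map_comp, Polynomial.map_sum, Polynomial.map_map, h1, hP', hQ', cA]
      using hpoly
  have hpolyC := congrArg (Polynomial.map (φ : A →+* C)) hpolyA
  have h1 : (φ : A →+* C).comp (algebraMap C A) = RingHom.id C := by ext; simp
  simp only [Polynomial.map_mul, Polynomial.map_sum, Polynomial.map_sub, Polynomial.map_comp,
    Polynomial.map_map, h1, Polynomial.map_id, Polynomial.map_C, Polynomial.map_add,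
    Polynomial.map_X, Polynomial.map_one] at hpolyC
  set P₁ := P'.map (φ : A →+* C)
  set Q₁ := Q'.map (φ : A →+* C) with hQ₁
  have hQ₁0 : aeval x Q₁ ≠ 0 := by
    rw [← aeval_map_algebraMap k, Ne, ← map_zero (aeval (R := k) x), hinj.eq_iff,
      Polynomial.map_eq_zero]
    intro h0
    have h2 := congrArg (fun p => coeff p Q.natDegree) h0
    simp only [hQ₁, coeff_map, coeff_zero] at h2
    have h3 : ((Q'.coeff Q.natDegree : A) : k) = Q.leadingCoeff := by
      conv_rhs => rw [leadingCoeff, ← hQ', coeff_map, hQ']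
      rfl
    refine hunit (Q'.coeff Q.natDegree) ?_ ?_ h2
    · rwa [h3, leadingCoeff_ne_zero]
    · rw [h3]; simp [S]
  have hσQ₁ : σ (aeval x Q₁) ≠ 0 := (map_ne_zero σ).2 hQ₁0
  refine ⟨fun i => φ (cA i), fun h0 => hunit (cA j) hj (by simp [S, cA]) (congrFun h0 j),
    aeval x P₁ / aeval x Q₁, ?_, ?_⟩
  · exact (IntermediateField.mem_adjoin_simple_iff C _).2 ⟨_, _, rfl⟩
  · have hE := congrArg (aeval x) hpolyC
    simp only [map_mul, map_sub, map_sum, aeval_C, hσC] at hE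
    have hsum : ∑ i, φ (cA i) • u i * aeval x B =
        ∑ i, algebraMap C F (φ (cA i)) * aeval x (N i) :=
      Finset.sum_congr rfl fun i _ => by rw [smul_mul_assoc, hN, Algebra.smul_def]
    rw [← Finset.sum_mul] at hsum
    have hE' : (∑ i, φ (cA i) • u i) * aeval x B * (aeval x Q₁ * σ (aeval x Q₁)) =
        aeval x B * (σ (aeval x P₁) * aeval x Q₁ - aeval x P₁ * σ (aeval x Q₁)) := by
      rw [hsum]; exact hE
    rw [map_div₀, div_sub_div _ _ hσQ₁ hQ₁0, eq_div_iff (mul_ne_zero hσQ₁ hQ₁0)]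
    apply mul_left_cancel₀ hB
    linear_combination hE'

end

/-! ### The field of meromorphic functions as a difference-differential field -/

namespace Mero

open Filter Topology
open scoped IntermediateField Polynomial

theorem ddx_X : ddx X = 1 := by
  rw [X, ddx_mk, ← map_one mk, mk_eq_mk]
  exact fun a => Eventually.of_forall fun x => deriv_id x

theorem shift_X : shift X = X + 1 := by
  rw [X, shift_mk, ← map_one mk, ← map_add]
  rfl

theorem shift_ddx (h : Mero) : shift (ddx h) = ddx (shift h) := by
  obtain ⟨h, rfl⟩ := mk_surjective h
  rw [ddx_mk, shift_mk, shift_mk, ddx_mk]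
  refine congrArg mk (Subtype.ext (funext fun x => ?_))
  exact (deriv_comp_add_const h.1 1 x).symm

theorem shift_iterate_ddx (n : ℕ) (h : Mero) : shift (ddx^[n] h) = ddx^[n] (shift h) :=
  Function.Semiconj.iterate_right (f := shift) (ga := ddx) (gb := ddx) shift_ddx n h

theorem shift_algebraMap (a : ℂ) : shift (algebraMap ℂ Mero a) = algebraMap ℂ Mero a := rfl

theorem mem_periodic {h : Mero} : h ∈ periodic ↔ shift h = h := Iff.rfl

theorem ddx_mem_periodic {h : Mero} (hh : h ∈ periodic) : ddx h ∈ periodic := by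
  rw [mem_periodic] at hh ⊢
  rw [shift_ddx, hh]

instance : CharZero Mero := charZero_of_injective_algebraMap (algebraMap ℂ Mero).injective

/-- The shift as a `k`-algebra homomorphism. -/
noncomputable def shiftAlgHom : Mero →ₐ[periodic] Mero :=
  { shift with commutes' := fun a => a.2 }

theorem shiftAlgHom_apply (h : Mero) : shiftAlgHom h = shift h := rfl

/-- The shift fixes periodic coefficients, so a polynomial killing x would also kill x + n for every
natural number n. -/
theorem transcendental_X : Transcendental periodic X := by
  rw [transcendental_iff]
  intro p hp
  have hroot : ∀ n : ℕ, Polynomial.aeval (X + n) p = 0 := by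
    intro n
    induction n with
    | zero => simpa using hp
    | succ n ih =>
      have := congrArg shiftAlgHom ih
      rw [← Polynomial.aeval_algHom_apply, map_zero, map_add, map_natCast, shiftAlgHom_apply,
        shift_X] at this
      rwa [Nat.cast_succ, add_comm (n : Mero) 1, ← add_assoc]
  classical
  by_contra hp0
  have hp1 : p.map (algebraMap periodic Mero) ≠ 0 := by
    rwa [Ne, Polynomial.map_eq_zero]
  refine Set.infinite_range_of_injective (f := fun n : ℕ => X + (n : Mero))
    (fun a b hab => Nat.cast_injective (add_left_cancel hab))
    (((p.map (algebraMap periodic Mero)).roots.toFinset.finite_toSet).subset ?_)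
  rintro _ ⟨n, rfl⟩
  simp [hp0, Polynomial.IsRoot, hroot n]

theorem X_mem_ratFunc (C : Type) [Field C] [Algebra C Mero] : X ∈ ratFunc C :=
  IntermediateField.mem_adjoin_simple_self C X

/-- The elements of `C` need not have derivative zero: the case C = k is needed, where `ddx` only
preserves k. -/
theorem ddx_mem_ratFunc {C : Type} [Field C] [Algebra C Mero]
    (hC : ∀ c : C, ddx (algebraMap C Mero c) ∈ ratFunc C) {h : Mero} (hh : h ∈ ratFunc C) :
    ddx h ∈ ratFunc C := by
  induction hh using IntermediateField.adjoin_induction with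
  | mem x hx =>
    rw [Set.mem_singleton_iff.1 hx, ddx_X]
    exact one_mem _
  | algebraMap x => exact hC x
  | add x y _ _ hx hy => rw [map_add]; exact add_mem hx hy
  | inv x hx h =>
    rw [Derivation.leibniz_inv]
    exact mul_mem (neg_mem (pow_mem (inv_mem hx) 2)) h
  | mul x y hx hy h1 h2 =>
    rw [Derivation.leibniz]
    exact add_mem (mul_mem hx h2) (mul_mem hy h1)

theorem iterate_ddx_mem_ratFunc {C : Type} [Field C] [Algebra C Mero]
    (hC : ∀ c : C, ddx (algebraMap C Mero c) ∈ ratFunc C) {h : Mero} (hh : h ∈ ratFunc C)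
    (n : ℕ) : ddx^[n] h ∈ ratFunc C := by
  induction n with
  | zero => exact hh
  | succ n ih => rw [Function.iterate_succ_apply']; exact ddx_mem_ratFunc hC ih

theorem ddx_algebraMap_periodic_mem (c : periodic) :
    ddx (algebraMap periodic Mero c) ∈ ratFunc periodic :=
  (ratFunc periodic).algebraMap_mem ⟨_, ddx_mem_periodic c.2⟩

theorem shift_mem_ratFunc {h : Mero} (hh : h ∈ ratFunc periodic) :
    shift h ∈ ratFunc periodic := by
  obtain ⟨r, s, rfl⟩ := (IntermediateField.mem_adjoin_simple_iff _ _).1 hh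
  rw [← shiftAlgHom_apply, map_div₀, ← Polynomial.aeval_algHom_apply,
    ← Polynomial.aeval_algHom_apply, shiftAlgHom_apply, shift_X]
  have h1 : X + 1 ∈ ratFunc periodic := add_mem (X_mem_ratFunc _) (one_mem _)
  have h2 : ∀ p : periodic[X], Polynomial.aeval (X + 1) p ∈ ratFunc periodic := fun p => by
    have := Polynomial.aeval_algHom_apply (ratFunc periodic).val ⟨_, h1⟩ p
    exact this ▸ SetLike.coe_mem _
  exact div_mem (h2 r) (h2 s)

/-- The shift of `k(x)`. -/
noncomputable def ratFuncShift : ratFunc periodic →+* ratFunc periodic :=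
  shift.restrict (ratFunc periodic) (ratFunc periodic) fun _ h => shift_mem_ratFunc h

theorem coe_ratFuncShift (h : ratFunc periodic) : (ratFuncShift h : Mero) = shift h := rfl

/-! ### The equivalences over k(x), and the passage to constants -/

theorem hasShiftRelation_of_isDifferentiallyAlgebraic {f z : Mero}
    (hf : f ∈ ratFunc periodic) (hz : shift z = z + f)
    (h : IsDifferentiallyAlgebraic ddx (ratFunc periodic) z) : HasShiftRelation periodic f := by
  obtain ⟨n, hn⟩ := h
  obtain ⟨c, hc0, hcτ, g, hg⟩ := exists_telescoper_of_not_algebraicIndependent shift ratFuncShift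
    (fun a => (coe_ratFuncShift a).symm) (fun i : Fin (n + 1) => ddx^[i] z)
    (fun i => ⟨ddx^[i] f, iterate_ddx_mem_ratFunc ddx_algebraMap_periodic_mem hf i⟩)
    (fun i => by
      rw [shift_iterate_ddx, hz]
      exact iterate_map_add ddx _ _ _) hn
  have hck : ∀ i, (c i : Mero) ∈ periodic := fun i => congrArg Subtype.val (hcτ i)
  let c' : Fin (n + 1) → periodic := fun i => ⟨c i, hck i⟩
  -- A zero coefficient is appended because the order must be positive while `n` may be 0.
  refine ⟨n + 1, n.succ_pos, Fin.snoc c' 0, fun h0 => hc0 (funext fun i => ?_), g, g.2, ?_⟩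
  · have : c' i = 0 := by
      simpa only [Fin.snoc_castSucc, Pi.zero_apply] using congrFun h0 i.castSucc
    exact Subtype.ext (congrArg (fun y : periodic => (y : Mero)) this)
  · rw [Fin.sum_univ_castSucc]
    simp only [Fin.snoc_castSucc, Fin.snoc_last, zero_smul, add_zero, Fin.val_castSucc]
    have := congrArg (algebraMap (ratFunc periodic) Mero) hg
    rw [map_sum, map_sub] at this
    exact this

theorem isDFinite_of_linear {K : IntermediateField periodic Mero} {z : Mero} {n : ℕ}
    (a : Fin (n + 1) → K) (ha : a ≠ 0) (h : ∑ i, a i • ddx^[i] z = 0) :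
    IsDFinite ddx K z := by
  refine ⟨⟨n, fun hn => ha (funext fun i => ?_)⟩, n, a, ha, h⟩
  exact Fintype.linearIndependent_iff.1 hn.linearIndependent a h i

theorem isDFinite_of_hasShiftRelation {f z : Mero} (hz : shift z = z + f)
    (h : HasShiftRelation periodic f) : IsDFinite ddx (ratFunc periodic) z := by
  obtain ⟨n, -, c, hc, g, hg, hrel⟩ := h
  let c' : ℕ → periodic := fun i => if hi : i < n + 1 then c ⟨i, hi⟩ else 0
  have hc' : ∀ i : Fin (n + 1), c' i = c i := fun i => dif_pos i.2
  set w := ∑ i : Fin (n + 1), (c i : Mero) * ddx^[i] z with hw_def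
  have hw : w ∈ ratFunc periodic := by
    have h1 : shift w = w + (shift g - g) := by
      rw [← hrel, hw_def, ← Finset.sum_add_distrib, map_sum]
      refine Finset.sum_congr rfl fun i _ => ?_
      rw [map_mul, mem_periodic.1 (c i).2, shift_iterate_ddx, hz, iterate_map_add ddx, mul_add]
      rfl
    have h2 : w - g ∈ periodic := by
      rw [mem_periodic, map_sub, h1]; ring
    have h3 : w - g ∈ ratFunc periodic := (ratFunc periodic).algebraMap_mem ⟨_, h2⟩
    simpa using add_mem h3 hg
  have hck : ∀ i, (c' i : Mero) ∈ ratFunc periodic := fun i =>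
    (ratFunc periodic).algebraMap_mem (c' i)
  have hdck : ∀ i, ddx (c' i : Mero) ∈ ratFunc periodic := fun i =>
    ddx_mem_ratFunc ddx_algebraMap_periodic_mem (hck i)
  have hdw := ddx_mem_ratFunc ddx_algebraMap_periodic_mem hw
  have hsum : ∑ i ∈ Finset.range (n + 1), (c' i : Mero) * ddx^[i] z = w := by
    rw [Finset.sum_range, hw_def]
    exact Finset.sum_congr rfl fun i _ => by rw [hc']
  obtain ⟨j, hj⟩ := Function.ne_iff.1 hc
  by_cases hw0 : w = 0
  · refine isDFinite_of_linear (n := n) (fun i => ⟨c' i, hck i⟩) (fun h0 => hj ?_) ?_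
    · have := congrArg Subtype.val (congrFun h0 j)
      exact Subtype.ext ((congrArg Subtype.val (hc' j)).symm.trans this)
    · rw [← hw0, ← hsum, Finset.sum_range]
      rfl
  -- With Lz = w, these are the coefficients of w · ∂(Lz) - ∂w · Lz, which vanishes at z.
  · let b : ℕ → Mero := fun i => w * (ddx (c' i : Mero) + if i = 0 then 0 else (c' (i - 1) : Mero))
      - ddx w * c' i
    have hb : ∀ i, b i ∈ ratFunc periodic := fun i => by
      refine sub_mem (mul_mem hw (add_mem (hdck i) ?_)) (mul_mem hdw (hck i))
      split_ifs
      exacts [zero_mem _, hck _]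
    refine isDFinite_of_linear (n := n + 1) (fun i => ⟨b i, hb i⟩) (fun h0 => ?_) ?_
    · have hb0 : ∀ i, i < n + 2 → b i = 0 := fun i hi =>
        congrArg Subtype.val (congrFun h0 ⟨i, hi⟩)
      -- Descending induction from c'(n + 1) = 0: once c'(i) = 0, the equation b(i) = 0 reduces to w
      -- · c'(i - 1) = 0.
      have hzero : ∀ i, i ≤ n + 1 → c' (n + 1 - i) = 0 := by
        intro i
        induction i with
        | zero => intro _; simp [c']
        | succ i ih =>
          intro hi
          have h1 := hb0 (n + 1 - i) (by omega)
          have h2 := ih (by omega)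
          have h3 : n + 1 - i ≠ 0 := by omega
          simp only [b, h2, h3, if_false, ZeroMemClass.coe_zero, map_zero, mul_zero, sub_zero,
            zero_add, mul_eq_zero, hw0, false_or] at h1
          exact Subtype.ext h1
      apply hj
      have := hzero (n + 1 - j) (by omega)
      rw [show n + 1 - (n + 1 - (j : ℕ)) = j by omega, hc'] at this
      exact this
    · have hd : ddx w = ∑ i ∈ Finset.range (n + 2),
          (ddx (c' i : Mero) + if i = 0 then 0 else (c' (i - 1) : Mero)) * ddx^[i] z := by
        simp_rw [add_mul, Finset.sum_add_distrib]
        rw [Finset.sum_range_succ, Finset.sum_range_succ' (fun i : ℕ =>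
          (if i = 0 then 0 else (c' (i - 1) : Mero)) * ddx^[i] z)]
        have : c' (n + 1) = 0 := by simp [c']
        simp only [this, ZeroMemClass.coe_zero, map_zero, zero_mul, add_zero, if_true,
          Nat.succ_ne_zero, if_false, Nat.add_sub_cancel]
        rw [← hsum, map_sum, ← Finset.sum_add_distrib]
        refine Finset.sum_congr rfl fun i _ => ?_
        rw [Derivation.leibniz, Function.iterate_succ_apply', smul_eq_mul, smul_eq_mul]
        ring
      have hs2 : ∑ i ∈ Finset.range (n + 2), (c' i : Mero) * ddx^[i] z = w := by
        rw [Finset.sum_range_succ, hsum]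
        simp [c']
      have : ∑ i ∈ Finset.range (n + 2), b i * ddx^[i] z = 0 := by
        simp only [b, sub_mul, mul_assoc, Finset.sum_sub_distrib, ← Finset.mul_sum]
        rw [← hd, hs2]
        ring
      rw [Finset.sum_range] at this
      exact this

theorem tfae_periodic {f z : Mero} (hfK : f ∈ ratFunc periodic) (hz : shift z = z + f) :
    List.TFAE [IsDifferentiallyAlgebraic ddx (ratFunc periodic) z,
      IsDFinite ddx (ratFunc periodic) z, HasShiftRelation periodic f] := by
  tfae_have 1 → 3 := hasShiftRelation_of_isDifferentiallyAlgebraic hfK hz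
  tfae_have 3 → 2 := isDFinite_of_hasShiftRelation hz
  tfae_have 2 → 1 := And.left
  tfae_finish

/-- Over an algebraically closed field `C` of constants, shift relations with coefficients in `C`
and in `k` are equivalent. -/
theorem hasShiftRelation_iff {C : Type} [Field C] [IsAlgClosed C] [Algebra C Mero]
    (hshift : ∀ c, shift (algebraMap C Mero c) = algebraMap C Mero c)
    (hddx : ∀ c, ddx (algebraMap C Mero c) = 0) {f : Mero} (hf : f ∈ ratFunc C) :
    HasShiftRelation periodic f ↔ HasShiftRelation C f := by
  -- Elements of `C` are shift-invariant, so `C` embeds in k.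
  let : Algebra C periodic := ((algebraMap C Mero).codRestrict periodic hshift).toAlgebra
  have : IsScalarTower C periodic Mero := IsScalarTower.of_algebraMap_eq fun _ => rfl
  constructor
  · rintro ⟨n, hn, c, hc, g, hg, h⟩
    obtain ⟨c', hc', g', hg', h'⟩ := exists_telescoper_of_extension transcendental_X shiftAlgHom
      shift_X (fun i : Fin (n + 1) => ddx^[i] f)
      (fun i => iterate_ddx_mem_ratFunc (fun c => hddx c ▸ zero_mem _) hf i) c hc hg h
    exact ⟨n, hn, c', hc', g', hg', h'⟩
  · rintro ⟨n, hn, c, hc, g, hg, h⟩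
    refine ⟨n, hn, fun i => algebraMap C periodic (c i), fun h0 => hc (funext fun i => ?_), g, ?_,
      by simpa only [algebraMap_smul] using h⟩
    · exact (map_eq_zero (algebraMap C periodic)).1 (congrFun h0 i)
    · obtain ⟨r, s, rfl⟩ := (IntermediateField.mem_adjoin_simple_iff _ _).1 hg
      rw [← Polynomial.aeval_map_algebraMap periodic,
        ← Polynomial.aeval_map_algebraMap periodic X s]
      exact (IntermediateField.mem_adjoin_simple_iff _ _).2 ⟨_, _, rfl⟩

end Mero

theorem corollary6p1 (f z : Mero) (hfK : f ∈ Mero.ratFunc Mero.periodic) (hf0 : f ≠ 0)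
    (hz : Mero.shift z = z + f) :
    List.TFAE
      [IsDifferentiallyAlgebraic Mero.ddx (Mero.ratFunc Mero.periodic) z,
        IsDFinite Mero.ddx (Mero.ratFunc Mero.periodic) z,
        Mero.HasShiftRelation Mero.periodic f] ∧
    (f ∈ Mero.ratFunc ℂ → List.TFAE
      [IsDifferentiallyAlgebraic Mero.ddx (Mero.ratFunc Mero.periodic) z,
        IsDFinite Mero.ddx (Mero.ratFunc Mero.periodic) z,
        Mero.HasShiftRelation Mero.periodic f,
        Mero.HasShiftRelation ℂ f]) ∧
    (f ∈ Mero.ratFunc (algebraicClosure ℚ ℂ) → List.TFAE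
      [IsDifferentiallyAlgebraic Mero.ddx (Mero.ratFunc Mero.periodic) z,
        IsDFinite Mero.ddx (Mero.ratFunc Mero.periodic) z,
        Mero.HasShiftRelation Mero.periodic f,
        Mero.HasShiftRelation (algebraicClosure ℚ ℂ) f]) := by
  have h := Mero.tfae_periodic hfK hz
  refine ⟨h, fun hf => ?_, fun hf => ?_⟩
  · have h34 := Mero.hasShiftRelation_iff (C := ℂ) Mero.shift_algebraMap
      Mero.ddx.map_algebraMap hf
    tfae_have 1 ↔ 2 := h.out 0 1
    tfae_have 1 ↔ 3 := h.out 0 2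
    tfae_have 3 ↔ 4 := h34
    tfae_finish
  · have : IsAlgClosed (algebraicClosure ℚ ℂ) := (algebraicClosure.isAlgClosure ℚ ℂ).isAlgClosed
    have h34 := Mero.hasShiftRelation_iff (C := algebraicClosure ℚ ℂ)
      (fun c => Mero.shift_algebraMap c) (fun c => Mero.ddx.map_algebraMap (c : ℂ)) hf
    tfae_have 1 ↔ 2 := h.out 0 1
    tfae_have 1 ↔ 3 := h.out 0 2
    tfae_have 3 ↔ 4 := h34
    tfae_finish
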